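/- Let $c\ge 3$ and $n\ge 2$ be integers. A $c$-edge-coloured multigraph is a finite loopless multigraph, not necessarily connected, each of whose edges has one of the colours $1,\dots,c$, such that no two parallel edges (edges joining the same pair of vertices) have the same colour. A proper Hamiltonian path is a path containing all the vertices in which any two adjacent edges have different colours. Every $c$-edge-coloured multigraph with $n$ vertices and at least $c\binom{n-1}{2}+1$ edges has a proper Hamiltonian path. This bound is tight: for all such $c$ and $n$ there is a $c$-edge-coloured multigraph with $n$ vertices and exactly $c\binom{n-1}{2}$ edges that has no proper Hamiltonian path. -/

import Mathlib

/-- A `c`-edge-coloured multigraph on the vertex set `V`. An edge is a pair consisting of its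
two endpoints and its colour; there are no loops. Parallel edges are allowed as long as they have
different colours, and no two parallel edges share a colour, since the edges form a set of pairs. -/
structure EdgeColouredMultigraph (V : Type*) (c : ℕ) where
  /-- The set of coloured edges. -/
  edgeSet : Set (Sym2 V × Fin c)
  /-- The endpoints of an edge are distinct. -/
  loopless : ∀ e ∈ edgeSet, ¬ e.1.IsDiag

namespace EdgeColouredMultigraph

variable {V : Type*} {c : ℕ}

/-- The number `m` of edges (a finite count when `V` is finite). Parallel edges of different
colours are counted separately. -/
noncomputable def numEdges (G : EdgeColouredMultigraph V c) : ℕ := G.edgeSet.ncard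

/-- A path with `l` edges: distinct vertices `x₀, …, x_l` together with, for every `i < l`, a chosen
edge joining `x_i` and `x_{i+1}`, given by its colour. -/
structure Path (G : EdgeColouredMultigraph V c) (l : ℕ) where
  /-- The vertices, in order. -/
  vertex : Fin (l + 1) → V
  /-- The colours of the edges, in order. -/
  colour : Fin l → Fin c
  /-- Consecutive vertices are joined by an edge of the given colour. -/
  edge_mem : ∀ i : Fin l, (s(vertex i.castSucc, vertex i.succ), colour i) ∈ G.edgeSet
  /-- The vertices are distinct. -/
  injective : Function.Injective vertex

/-- A path is Hamiltonian if it contains all the vertices. -/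
def Path.IsHamiltonian {G : EdgeColouredMultigraph V c} {l : ℕ} (P : G.Path l) : Prop :=
  Function.Surjective P.vertex

/-- A path is proper if any two adjacent edges of it, that is, any two edges that are consecutive
on it, have different colours. -/
def Path.IsProper {G : EdgeColouredMultigraph V c} {l : ℕ} (P : G.Path l) : Prop :=
  ∀ i j : Fin l, (j : ℕ) = (i : ℕ) + 1 → P.colour i ≠ P.colour j

/-- The multigraph has a proper Hamiltonian path. -/
def HasProperHamiltonianPath (G : EdgeColouredMultigraph V c) : Prop :=
  ∃ (l : ℕ) (P : G.Path l), P.IsHamiltonian ∧ P.IsProper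

end EdgeColouredMultigraph

/-! Some three colours together carry more than $3\binom{n-1}{2}$ edges (`exists_three_heavy`), so
three colours suffice. Then fewer than $3(n-1)$ edges are missing from the complete three-coloured
multigraph; the ordered sum of `w` doubles this to $6(n-1)$.

`exists_proper_list` inducts on $n$. If some vertex $l$ misses at most two edges, delete $l$ and a
vertex $h$ chosen by averaging (`exists_pair_erase`); so few missing edges let the remaining path be
extended by $l$, then $h$, at one of its ends (`exists_extend_pair`). Otherwise every vertex misses
at least three edges, so deleting any vertex preserves the bound; one that misses at most $n$ edges
can be inserted back (`exists_insert`).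

Tightness: an isolated vertex beside a complete multigraph. -/

/-- A list of pairs (colour of the incoming edge, vertex) describes a properly coloured walk. The
colour at the head of the list belongs to no edge and is only required to differ from the next. -/
def ProperStep {V C : Type*} (E : V → V → Finset C) (p q : C × V) : Prop :=
  q.1 ∈ E p.2 q.2 ∧ p.1 ≠ q.1

/-! ### Inserting vertices into properly coloured walks. -/

namespace ProperStep

variable {V C : Type*} {E : V → V → Finset C}

/-- The head colour enters only one inequality, so a single value `m` is forbidden. A vertex can be
put in front through any colour other than `m`. -/
theorem exists_forall_isChain_cons [Nontrivial C] {k : C} {x : V} {t : List (C × V)}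
    (h : List.IsChain (ProperStep E) ((k, x) :: t)) :
    ∃ m, m ≠ k ∧ ∀ b, b ≠ m → List.IsChain (ProperStep E) ((b, x) :: t) := by
  cases t with
  | nil =>
    obtain ⟨m, hm⟩ := exists_ne k
    exact ⟨m, hm, fun b _ => by simp⟩
  | cons q t =>
    rw [List.isChain_cons_cons] at h
    refine ⟨q.1, h.1.2.symm, fun b hb => ?_⟩
    rw [List.isChain_cons_cons]
    exact ⟨⟨h.1.1, hb⟩, h.2⟩

/-- For `s` and `t` the colours usable on two consecutive edges: if each has at most two elements, a
failure to choose properly leaves at most two in total. -/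
theorem no_distinct_pair {s t : Finset C} (h : ∀ a ∈ s, ∀ b ∈ t, a = b) :
    s.card = 0 ∨ t.card = 0 ∨ (s.card = 1 ∧ t.card = 1) := by
  rcases s.eq_empty_or_nonempty with rfl | ⟨a, ha⟩
  · simp
  rcases t.eq_empty_or_nonempty with rfl | ⟨b, hb⟩
  · simp
  refine Or.inr (Or.inr ⟨Finset.card_eq_one.2 ⟨b, ?_⟩, Finset.card_eq_one.2 ⟨a, ?_⟩⟩)
  · ext x
    simp only [Finset.mem_singleton]
    exact ⟨fun hx => h x hx b hb, fun hx => hx ▸ (h a ha b hb) ▸ ha⟩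
  · ext x
    simp only [Finset.mem_singleton]
    exact ⟨fun hx => (h a ha x hx).symm, fun hx => hx ▸ (h a ha b hb) ▸ hb⟩

theorem exists_distinct_pair {s t : Finset C} (hs : s.card ≠ 0) (ht : t.card ≠ 0)
    (h : 2 < s.card + t.card) : ∃ a ∈ s, ∃ b ∈ t, a ≠ b := by
  by_contra! hc
  have := no_distinct_pair hc
  omega

variable [DecidableEq C]

theorem card_le_card_erase_add_card_erase (s : Finset C) {a b : C} (h : a ≠ b) :
    s.card ≤ (s.erase a).card + (s.erase b).card := by
  have : s = s.erase a ∪ s.erase b := by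
    ext x
    simp only [Finset.mem_union, Finset.mem_erase]
    grind
  calc s.card = (s.erase a ∪ s.erase b).card := by rw [← this]
    _ ≤ _ := Finset.card_union_le _ _

variable [Fintype C]

theorem card_erase_le_two (hC : Fintype.card C = 3) (s : Finset C) (k : C) :
    (s.erase k).card ≤ 2 := by
  have h1 : (s.erase k).card ≤ (Finset.univ.erase k).card :=
    Finset.card_le_card (Finset.erase_subset_erase _ (Finset.subset_univ _))
  rw [Finset.card_erase_of_mem (Finset.mem_univ _), Finset.card_univ, hC] at h1
  exact h1

/-- If a vertex `v` cannot be inserted behind the head of a properly coloured walk, then it sends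
few edges to that walk. -/
theorem card_le_of_not_insert_tail (hC : Fintype.card C = 3) (hE : ∀ x y, E x y = E y x) (v : V)
    (t : List (C × V)) (k : C) (x : V) (h : List.IsChain (ProperStep E) ((k, x) :: t))
    (hno : ¬ ∃ q : List (C × V), List.IsChain (ProperStep E) ((k, x) :: q) ∧
      (q.map Prod.snd).Perm (v :: t.map Prod.snd)) :
    ((E v x).erase k).card + (t.map fun q => (E v q.2).card).sum ≤ 2 * t.length := by
  have : Nontrivial C := Fintype.one_lt_card_iff_nontrivial.1 (by omega)
  induction t generalizing k x with
  | nil =>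
    have : (E v x).erase k = ∅ := by
      rw [Finset.eq_empty_iff_forall_notMem]
      intro a ha
      rw [Finset.mem_erase] at ha
      refine hno ⟨[(a, v)], ?_, by simp⟩
      simp only [List.isChain_cons_cons, List.isChain_singleton, and_true]
      exact ⟨by rw [hE]; exact ha.2, ha.1.symm⟩
    simp [this]
  | cons q t ih =>
    obtain ⟨k', x'⟩ := q
    rw [List.isChain_cons_cons] at h
    have ih' := ih k' x' h.2 (by
      rintro ⟨q, hq, hp⟩
      refine hno ⟨(k', x') :: q, List.isChain_cons_cons.2 ⟨h.1, hq⟩, ?_⟩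
      simp only [List.map_cons]
      exact (hp.cons x').trans (List.Perm.swap _ _ _))
    -- Since `m ≠ k'`, each colour from `v` to `x'` survives one of the two erasures: `erase m` is
    -- charged to the gap before `x'`, `erase k'` to the gap after it. Each gap takes at most 2.
    obtain ⟨m, hm, hmc⟩ := exists_forall_isChain_cons h.2
    have hd := card_le_card_erase_add_card_erase (E v x') hm
    have ha := card_erase_le_two hC (E v x) k
    have hb := card_erase_le_two hC (E v x') m
    have := no_distinct_pair (s := (E v x).erase k) (t := (E v x').erase m) (by
      intro a ha b hb
      by_contra hab
      rw [Finset.mem_erase] at ha hb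
      refine hno ⟨(a, v) :: (b, x') :: t, ?_, by simp⟩
      rw [List.isChain_cons_cons, List.isChain_cons_cons]
      exact ⟨⟨by rw [hE]; exact ha.2, ha.1.symm⟩, ⟨hb.2, hab⟩, hmc b hb.1⟩)
    simp only [List.map_cons, List.sum_cons, List.length_cons]
    omega

/-- A vertex with many edges to a properly coloured walk can be inserted into it. -/
theorem exists_insert (hC : Fintype.card C = 3) (hE : ∀ x y, E x y = E y x) (v : V)
    (p : List (C × V)) (hp : p ≠ []) (h : List.IsChain (ProperStep E) p)
    (hdeg : 2 * p.length < (p.map fun q => (E v q.2).card).sum + 2) :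
    ∃ q : List (C × V), List.IsChain (ProperStep E) q ∧
      (q.map Prod.snd).Perm (v :: p.map Prod.snd) := by
  have : Nontrivial C := Fintype.one_lt_card_iff_nontrivial.1 (by omega)
  obtain _ | ⟨⟨k, x⟩, t⟩ := p
  · exact absurd rfl hp
  by_contra hno
  have h1 := card_le_of_not_insert_tail hC hE v t k x h (by
    rintro ⟨q, hq, hpq⟩
    refine hno ⟨_, hq, ?_⟩
    simp only [List.map_cons]
    exact (hpq.cons x).trans (List.Perm.swap _ _ _))
  obtain ⟨m, hm, hmc⟩ := exists_forall_isChain_cons h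
  have hd := card_le_card_erase_add_card_erase (E v x) hm
  -- Prepending `v` also fails, so all colours from `v` to `x` are already counted in the gap after
  -- `x`.
  have hb : (E v x).erase m = ∅ := by
    rw [Finset.eq_empty_iff_forall_notMem]
    intro b hb
    rw [Finset.mem_erase] at hb
    obtain ⟨j, hj⟩ := exists_ne b
    refine hno ⟨(j, v) :: (b, x) :: t, ?_, by simp⟩
    rw [List.isChain_cons_cons]
    exact ⟨⟨hb.2, hj⟩, hmc b hb.1⟩
  rw [hb] at hd
  simp only [List.map_cons, List.sum_cons, List.length_cons, Finset.card_empty] at hd hdeg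
  omega

/-- If `l` misses at most two edges to the two ends of a properly coloured walk and to `h`, then
the walk extends by `l` and `h`. -/
theorem exists_extend_pair (hC : Fintype.card C = 3) (hE : ∀ x y, E x y = E y x) (l h x y : V)
    (k k' : C) (t : List (C × V))
    (hp : List.IsChain (ProperStep E) ((k, x) :: (t ++ [(k', y)])))
    (hdeg : 7 ≤ (E l x).card + (E l y).card + (E l h).card) :
    ∃ q : List (C × V), List.IsChain (ProperStep E) q ∧
      (q.map Prod.snd).Perm (l :: h :: ((k, x) :: (t ++ [(k', y)])).map Prod.snd) := by
  have : Nontrivial C := Fintype.one_lt_card_iff_nontrivial.1 (by omega)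
  obtain ⟨m, hm, hmc⟩ := exists_forall_isChain_cons hp
  have hx := Finset.pred_card_le_card_erase (s := E l x) (a := m)
  have hy := Finset.pred_card_le_card_erase (s := E l y) (a := k')
  have h1 : (E l x).card ≤ 3 := hC ▸ Finset.card_le_univ _
  have h2 : (E l y).card ≤ 3 := hC ▸ Finset.card_le_univ _
  have h3 : (E l h).card ≤ 3 := hC ▸ Finset.card_le_univ _
  -- In this case `l` has all three colours to both `x` and `h`, so the front works; otherwise the
  -- end at `y` does.
  by_cases hc : (E l y).card ≤ 1
  · obtain ⟨a, ha, b, hb, hab⟩ := exists_distinct_pair (s := (E l x).erase m) (t := E l h)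
      (by omega) (by omega) (by omega)
    rw [Finset.mem_erase] at ha
    obtain ⟨j, hj⟩ := exists_ne b
    refine ⟨(j, h) :: (b, l) :: (a, x) :: (t ++ [(k', y)]), ?_, by
      simpa using List.Perm.swap _ _ _⟩
    rw [List.isChain_cons_cons, List.isChain_cons_cons]
    exact ⟨⟨by rw [hE]; exact hb, hj⟩, ⟨ha.2, hab.symm⟩, hmc a ha.1⟩
  · obtain ⟨a, ha, b, hb, hab⟩ := exists_distinct_pair (s := (E l y).erase k') (t := E l h)
      (by omega) (by omega) (by omega)
    rw [Finset.mem_erase] at ha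
    refine ⟨((k, x) :: (t ++ [(k', y)])) ++ [(a, l), (b, h)], ?_, ?_⟩
    · refine List.IsChain.append hp ?_ ?_
      · simp only [List.isChain_cons_cons, List.isChain_singleton, and_true]
        exact ⟨hb, hab⟩
      · intro u hu w hw
        simp at hw
        rw [← List.cons_append, List.getLast?_append] at hu
        simp at hu
        subst hu hw
        exact ⟨by rw [hE]; exact ha.2, ha.1.symm⟩
    · rw [List.map_append]
      exact List.perm_append_comm

end ProperStep

/-! ### Induction on the number of missing edges and vertices. -/

section Deficiency

variable {V : Type*} [DecidableEq V]

theorem sum_sum_erase {w : V → V → ℕ} (hw : ∀ x y, w x y = w y x) (h0 : ∀ x, w x x = 0)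
    {S : Finset V} {v : V} (hv : v ∈ S) :
    ∑ x ∈ S, ∑ y ∈ S, w x y =
      ∑ x ∈ S.erase v, ∑ y ∈ S.erase v, w x y + 2 * ∑ y ∈ S, w v y := by
  have h1 : ∀ x, ∑ y ∈ S, w x y = ∑ y ∈ S.erase v, w x y + w x v := fun x =>
    (Finset.sum_erase_add S (w x) hv).symm
  rw [← Finset.sum_erase_add S _ hv, Finset.sum_congr rfl (fun x _ => h1 x),
    Finset.sum_add_distrib, Finset.sum_congr rfl (fun x _ => hw x v)]
  have h2 := h1 v
  rw [h0] at h2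
  linarith

/-- Averaging: let $W$ be the sum over `S.erase l` and $s$ the size of `S`. If every `h` failed,
summing over `h` would give $6(s-1)(s-3) + 2W \le (s-1)W$, hence $W \ge 6(s-1)$. -/
theorem exists_pair_erase {w : V → V → ℕ} (hw : ∀ x y, w x y = w y x) (h0 : ∀ x, w x x = 0)
    {S : Finset V} (hS : 4 ≤ S.card) (hW : ∑ x ∈ S, ∑ y ∈ S, w x y < 6 * (S.card - 1))
    {l : V} (hl : l ∈ S) :
    ∃ h ∈ S.erase l, ∑ x ∈ (S.erase l).erase h, ∑ y ∈ (S.erase l).erase h, w x y <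
      6 * (S.card - 3) := by
  by_contra! hc
  have hcard := Finset.card_erase_of_mem hl
  have h1 := sum_sum_erase hw h0 hl
  have h2 : ∀ h ∈ S.erase l, 6 * (S.card - 3) + 2 * ∑ y ∈ S.erase l, w h y ≤
      ∑ x ∈ S.erase l, ∑ y ∈ S.erase l, w x y := by
    intro h hh
    rw [sum_sum_erase hw h0 hh]
    have := hc h hh
    omega
  have h3 := Finset.sum_le_sum h2
  rw [Finset.sum_add_distrib] at h3
  simp only [Finset.sum_const, smul_eq_mul, hcard, ← Finset.mul_sum] at h3
  obtain ⟨r, hr⟩ := Nat.exists_eq_add_of_le hS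
  rw [hr] at h3 hW
  have e1 : 4 + r - 1 = r + 3 := by omega
  have e2 : 4 + r - 3 = r + 1 := by omega
  rw [e1, e2] at h3
  rw [e1] at hW
  have h4 : ∑ x ∈ S.erase l, ∑ y ∈ S.erase l, w x y < 6 * (r + 3) := by omega
  nlinarith

theorem list_sum_map_eq_sum {C : Type*} (p : List (C × V)) (hp : (p.map Prod.snd).Nodup)
    (f : V → ℕ) :
    (p.map fun q => f q.2).sum = ∑ x ∈ (p.map Prod.snd).toFinset, f x := by
  rw [List.sum_toFinset f hp, List.map_map]
  rfl

/-- The three-colour form of the theorem, by induction on the number of vertices; `w x y` counts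
the colours missing between `x` and `y`. -/
theorem exists_proper_list {C : Type*} [Fintype C] [DecidableEq C] (hC : Fintype.card C = 3)
    {E : V → V → Finset C} (hE : ∀ x y, E x y = E y x) {w : V → V → ℕ} (h0 : ∀ x, w x x = 0)
    (hw : ∀ x y, w x y = w y x) (hEw : ∀ x y, x ≠ y → (E x y).card + w x y = 3)
    (n : ℕ) (S : Finset V) (hn : S.card = n) (h2 : 2 ≤ n)
    (hW : ∑ x ∈ S, ∑ y ∈ S, w x y < 6 * (n - 1)) :
    ∃ p : List (C × V), p.IsChain (ProperStep E) ∧ (p.map Prod.snd).Nodup ∧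
      (p.map Prod.snd).toFinset = S := by
  have : Nontrivial C := Fintype.one_lt_card_iff_nontrivial.1 (by omega)
  induction n using Nat.strong_induction_on generalizing S with
  | _ n ih =>
  -- Two base cases, because the induction may remove two vertices.
  obtain rfl | rfl | h4 : n = 2 ∨ n = 3 ∨ 4 ≤ n := by omega
  · obtain ⟨x, y, hxy, rfl⟩ := Finset.card_eq_two.1 hn
    rw [Finset.sum_pair hxy, Finset.sum_pair hxy, Finset.sum_pair hxy, h0, h0, hw y x] at hW
    have := hEw x y hxy
    obtain ⟨a, ha⟩ : (E x y).Nonempty := Finset.card_pos.1 (by omega)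
    obtain ⟨j, hj⟩ := exists_ne a
    refine ⟨[(j, x), (a, y)], ?_, by simpa using hxy, by simp⟩
    simp only [List.isChain_cons_cons, List.isChain_singleton, and_true]
    exact ⟨ha, hj⟩
  · have key : ∀ x y z, x ≠ y → x ≠ z → y ≠ z → S = {x, y, z} →
        (∃ a ∈ E x y, ∃ b ∈ E y z, a ≠ b) → ∃ p : List (C × V), p.IsChain (ProperStep E) ∧
          (p.map Prod.snd).Nodup ∧ (p.map Prod.snd).toFinset = S := by
      rintro x y z hxy hxz hyz rfl ⟨a, ha, b, hb, hab⟩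
      obtain ⟨j, hj⟩ := exists_ne a
      refine ⟨[(j, x), (a, y), (b, z)], ?_, by simp [hxy, hxz, hyz], by simp⟩
      simp only [List.isChain_cons_cons, List.isChain_singleton, and_true]
      exact ⟨⟨ha, hj⟩, hb, hab⟩
    obtain ⟨x, y, z, hxy, hxz, hyz, hS⟩ := Finset.card_eq_three.1 hn
    -- Without a proper path the triangle has at most three edges, whereas `hW` leaves at least four
    -- of the nine.
    by_contra hno
    have f1 := ProperStep.no_distinct_pair (s := E x y) (t := E y z) (by
      by_contra! hc
      exact hno (key x y z hxy hxz hyz hS hc))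
    have f2 := ProperStep.no_distinct_pair (s := E y z) (t := E z x) (by
      by_contra! hc
      exact hno (key y z x hyz hxy.symm hxz.symm (by rw [hS]; ext; simp; tauto) hc))
    have f3 := ProperStep.no_distinct_pair (s := E z x) (t := E x y) (by
      by_contra! hc
      exact hno (key z x y hxz.symm hyz.symm hxy (by rw [hS]; ext; simp; tauto) hc))
    have g1 := hEw x y hxy
    have g2 := hEw y z hyz
    have g3 := hEw z x hxz.symm
    have s3 : ∀ f : V → ℕ, ∑ u ∈ S, f u = f x + (f y + f z) := by
      intro f
      rw [hS, Finset.sum_insert (by simp [hxy, hxz]), Finset.sum_pair hyz]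
    simp only [s3, h0, hw y x, hw z y, hw x z] at hW
    omega
  · by_cases hlight : ∃ l ∈ S, ∑ y ∈ S, w l y ≤ 2
    · obtain ⟨l, hl, hdl⟩ := hlight
      obtain ⟨h, hh, hlt⟩ := exists_pair_erase hw h0 (by omega) (hn ▸ hW) hl
      have c1 := Finset.card_erase_of_mem hl
      have c2 := Finset.card_erase_of_mem hh
      obtain ⟨p, hp, hnd, hpS⟩ := ih (n - 2) (by omega) ((S.erase l).erase h) (by omega)
        (by omega) (by rw [hn] at hlt; convert hlt using 2; omega)
      have hlen : p.length = n - 2 := by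
        have := List.toFinset_card_of_nodup hnd
        rw [hpS, List.length_map] at this
        omega
      obtain ⟨k, x, t, k', y, rfl⟩ : ∃ k x t k' y, p = (k, x) :: (t ++ [(k', y)]) := by
        obtain _ | ⟨⟨k, x⟩, t⟩ := p
        · simp at hlen; omega
        obtain rfl | ⟨t, ⟨k', y⟩, rfl⟩ := t.eq_nil_or_concat
        · simp at hlen; omega
        · exact ⟨k, x, t, k', y, by simp⟩
      have hxy : x ≠ y := by
        rintro rfl
        simp at hnd
      have hx : x ∈ (S.erase l).erase h := by rw [← hpS]; simp
      have hy : y ∈ (S.erase l).erase h := by rw [← hpS]; simp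
      simp only [Finset.mem_erase] at hx hy hh
      have hsub : ∑ u ∈ {x, y, h}, w l u ≤ ∑ u ∈ S, w l u := by
        apply Finset.sum_le_sum_of_subset
        intro u
        simp only [Finset.mem_insert, Finset.mem_singleton]
        rintro (rfl | rfl | rfl)
        · exact hx.2.2
        · exact hy.2.2
        · exact hh.2
      rw [Finset.sum_insert (by simp [hxy, hx.1]), Finset.sum_pair hy.1] at hsub
      have e1 := hEw l x hx.2.1.symm
      have e2 := hEw l y hy.2.1.symm
      have e3 := hEw l h hh.1.symm
      obtain ⟨q, hq, hqp⟩ := ProperStep.exists_extend_pair hC hE l h x y k k' t hp (by omega)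
      refine ⟨q, hq, ?_, ?_⟩
      · rw [hqp.nodup_iff, List.nodup_cons, List.nodup_cons]
        refine ⟨?_, ?_, hnd⟩
        · rw [List.mem_cons, ← List.mem_toFinset, hpS]
          simp [hh.1.symm]
        · rw [← List.mem_toFinset, hpS]
          simp
      · rw [List.toFinset_eq_of_perm _ _ hqp, List.toFinset_cons, List.toFinset_cons, hpS,
          Finset.insert_erase (by simp [hh]), Finset.insert_erase hl]
    · push Not at hlight
      -- Otherwise the total is at least $n(n+1)$, and $n(n+1) \ge 6(n-1)$ because $(n-2)(n-3) \ge
      -- 0$. Such a `v` sends at least $3(n-1)-n = 2(n-1)-1$ edges to the rest, exactly what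
      -- `exists_insert` needs.
      obtain ⟨v, hv, hdv⟩ : ∃ v ∈ S, ∑ y ∈ S, w v y ≤ n := by
        by_contra! hc
        have := Finset.card_nsmul_le_sum S _ (n + 1) hc
        rw [hn, smul_eq_mul] at this
        obtain ⟨r, rfl⟩ := Nat.exists_eq_add_of_le h4
        have e1 : 4 + r - 1 = r + 3 := by omega
        rw [e1] at hW
        nlinarith
      have hsum := sum_sum_erase hw h0 hv
      have hdv3 := hlight v hv
      have c1 := Finset.card_erase_of_mem hv
      obtain ⟨p, hp, hnd, hpS⟩ := ih (n - 1) (by omega) (S.erase v) (by omega) (by omega)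
        (by omega)
      have hlen : p.length = n - 1 := by
        have := List.toFinset_card_of_nodup hnd
        rw [hpS, List.length_map] at this
        omega
      have hdeg : ∑ x ∈ S.erase v, (E v x).card + ∑ x ∈ S, w v x = 3 * (n - 1) := by
        rw [← Finset.sum_erase_add S _ hv, h0, add_zero, ← Finset.sum_add_distrib,
          Finset.sum_congr rfl (fun x hx => hEw v x (Finset.ne_of_mem_erase hx).symm)]
        simp only [Finset.sum_const, smul_eq_mul]
        rw [c1, hn, mul_comm]
      obtain ⟨q, hq, hqp⟩ := ProperStep.exists_insert hC hE v p
        (by rintro rfl; simp at hlen; omega) hp (by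
          rw [list_sum_map_eq_sum p hnd fun x => (E v x).card, hpS]
          omega)
      refine ⟨q, hq, ?_, ?_⟩
      · rw [hqp.nodup_iff, List.nodup_cons]
        refine ⟨?_, hnd⟩
        rw [← List.mem_toFinset, hpS]
        simp
      · rw [List.toFinset_eq_of_perm _ _ hqp, List.toFinset_cons, hpS, Finset.insert_erase hv]

end Deficiency

/-! ### Reduction to three colours. -/

theorem exists_three_heavy {K : Type*} [DecidableEq K] (a : K → ℕ) (N : ℕ) (S : Finset K)
    (hS : 3 ≤ S.card) (h : S.card * N < ∑ k ∈ S, a k) :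
    ∃ T : Finset K, T.card = 3 ∧ 3 * N < ∑ k ∈ T, a k := by
  induction S using Finset.strongInduction with
  | H S ih =>
  by_cases hc : S.card = 3
  · exact ⟨S, hc, hc ▸ h⟩
  -- Discarding a value at most `N` keeps the average above `N`; if there is none, any three
  -- elements work.
  by_cases hk : ∃ k ∈ S, a k ≤ N
  · obtain ⟨k, hk, hak⟩ := hk
    have h1 := Finset.sum_erase_add S a hk
    have h2 := Finset.card_erase_add_one hk
    refine ih _ (Finset.erase_ssubset hk) (by omega) ?_
    rw [← h2, add_mul, one_mul] at h
    omega
  · push Not at hk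
    obtain ⟨T, hTS, hT⟩ := Finset.exists_subset_card_eq hS
    refine ⟨T, hT, ?_⟩
    rw [← hT, ← smul_eq_mul]
    exact Finset.sum_lt_sum_of_nonempty (s := T) (f := fun _ => N) (Finset.card_pos.1 (by omega))
      (fun k hk' => hk k (hTS hk')) |>.trans_eq' (by simp)

/-! ### Passing between multigraphs and lists, and tightness. -/

namespace EdgeColouredMultigraph

variable {V : Type*} {c : ℕ}

/-- The simple graph formed by the edges of one colour. -/
def colourGraph (G : EdgeColouredMultigraph V c) (k : Fin c) : SimpleGraph V where
  Adj x y := (s(x, y), k) ∈ G.edgeSet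
  symm := ⟨fun x y h => by rwa [Sym2.eq_swap]⟩
  loopless := ⟨fun x h => G.loopless _ h (by simp)⟩

theorem numEdges_eq_sum [Fintype V] (G : EdgeColouredMultigraph V c) :
    G.numEdges = ∑ k, (G.colourGraph k).edgeSet.ncard := by
  classical
  have h : ∀ k, (G.colourGraph k).edgeSet.ncard =
      (Finset.univ.filter fun e : Sym2 V => (e, k) ∈ G.edgeSet).card := by
    intro k
    rw [← Set.ncard_coe_finset]
    congr 1
    ext e
    induction e using Sym2.ind
    simp [colourGraph]
  simp only [h]
  rw [numEdges, Set.ncard_eq_toFinset_card']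
  simp only [Finset.card_filter]
  rw [Finset.sum_comm, ← Finset.sum_product', ← Finset.card_filter]
  congr 1
  ext e
  simp

/-- The handshake lemma in each colour of `T`. -/
theorem sum_card_colours [Fintype V] [DecidableEq V] (G : EdgeColouredMultigraph V c)
    (T : Finset (Fin c)) [∀ x y, DecidablePred fun k : T => (s(x, y), k.1) ∈ G.edgeSet] :
    ∑ x, ∑ y, (Finset.univ.filter fun k : T => (s(x, y), k.1) ∈ G.edgeSet).card =
      2 * ∑ k ∈ T, (G.colourGraph k).edgeSet.ncard := by
  classical
  have h : ∀ k, ∑ x, ∑ y, (if (s(x, y), k) ∈ G.edgeSet then 1 else 0) =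
      2 * (G.colourGraph k).edgeSet.ncard := by
    intro k
    rw [Set.ncard_eq_toFinset_card', ← SimpleGraph.edgeFinset,
      ← SimpleGraph.sum_degrees_eq_twice_card_edges]
    refine Finset.sum_congr rfl fun x _ => ?_
    rw [← Finset.card_filter, ← SimpleGraph.card_neighborFinset_eq_degree]
    congr 1
    ext y
    rw [SimpleGraph.mem_neighborFinset, Finset.mem_filter]
    simp [colourGraph]
  simp only [Finset.card_filter]
  rw [Finset.mul_sum, ← Finset.sum_coe_sort T]
  simp only [← h]
  refine Eq.trans (Finset.sum_congr rfl fun x _ => ?_) Finset.sum_comm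
  exact Finset.sum_comm.trans (by congr!)

theorem hasProperHamiltonianPath_of_list (G : EdgeColouredMultigraph V c) {C : Type*} (f : C → Fin c)
    (hf : Function.Injective f) {E : V → V → Finset C}
    (hE : ∀ x y k, k ∈ E x y → (s(x, y), f k) ∈ G.edgeSet) (p : List (C × V)) (hp0 : p ≠ [])
    (hp : p.IsChain (ProperStep E)) (hnd : (p.map Prod.snd).Nodup)
    (hall : ∀ x, x ∈ p.map Prod.snd) : G.HasProperHamiltonianPath := by
  obtain ⟨l, hl⟩ : ∃ l, p.length = l + 1 :=
    Nat.exists_eq_succ_of_ne_zero (by simpa using hp0)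
  rw [List.isChain_iff_getElem] at hp
  -- Edge `i` takes the colour stored at position `i + 1`; the dummy colour at the head is dropped.
  refine ⟨l, ⟨fun i => (p[(i : ℕ)]'(by omega)).2, fun i => f (p[(i : ℕ) + 1]'(by omega)).1,
    fun i => hE _ _ _ (hp i (by omega)).1, ?_⟩, ?_, ?_⟩
  · intro i j hij
    have := List.nodup_iff_injective_get.1 hnd
    have h2 := @this ⟨i, by simp; omega⟩ ⟨j, by simp; omega⟩ (by simpa using hij)
    simpa [Fin.ext_iff] using h2
  · intro x
    obtain ⟨i, hi, hx⟩ := List.getElem_of_mem (hall x)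
    rw [List.length_map] at hi
    exact ⟨⟨i, by omega⟩, by simpa using hx⟩
  · intro i j hij h
    have h1 := (hp j (by omega)).2
    have h2 := hf h
    simp only [hij] at h1 h2
    exact h1 h2

theorem hasProperHamiltonianPath_of_le [Fintype V] (G : EdgeColouredMultigraph V c) (hc : 3 ≤ c)
    (hn : 2 ≤ Fintype.card V)
    (h : c * (Fintype.card V - 1).choose 2 + 1 ≤ G.numEdges) : G.HasProperHamiltonianPath := by
  classical
  rw [numEdges_eq_sum] at h
  obtain ⟨T, hT, hTN⟩ := exists_three_heavy (fun k => (G.colourGraph k).edgeSet.ncard)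
    ((Fintype.card V - 1).choose 2) Finset.univ (by simpa using hc) (by simp; omega)
  let E : V → V → Finset T := fun x y =>
    Finset.univ.filter fun k : T => (s(x, y), k.1) ∈ G.edgeSet
  have hsum : ∑ x, ∑ y, (E x y).card = _ := G.sum_card_colours T
  have hE3 : ∀ x y, (E x y).card ≤ 3 := fun x y => (Finset.card_le_univ _).trans (by simp [hT])
  have hEd : ∀ x, E x x = ∅ := fun x => by
    simp only [E, Finset.filter_eq_empty_iff]
    exact fun k _ hk => G.loopless _ hk (by simp)
  have hEs : ∀ x y, E x y = E y x := fun x y => by simp only [E, Sym2.eq_swap]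
  -- Zero on the diagonal, where no edge counts as missing.
  let w : V → V → ℕ := fun x y => if x = y then 0 else 3 - (E x y).card
  have htot : ∑ x, ∑ y, (E x y).card + ∑ x, ∑ y, w x y =
      Fintype.card V * ((Fintype.card V - 1) * 3) := by
    rw [← Finset.sum_add_distrib, ← smul_eq_mul, ← Finset.card_univ, ← Finset.sum_const]
    refine Finset.sum_congr rfl fun x _ => ?_
    rw [← Finset.sum_add_distrib, ← Finset.card_erase_of_mem (Finset.mem_univ x), ← smul_eq_mul,
      ← Finset.sum_const, ← Finset.sum_erase_add _ _ (Finset.mem_univ x)]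
    simp only [w, hEd, if_true, Finset.card_empty, add_zero]
    refine Finset.sum_congr rfl fun y hy => ?_
    rw [if_neg (Finset.ne_of_mem_erase hy).symm]
    have := hE3 x y
    omega
  obtain ⟨p, hp, hnd, hpS⟩ := exists_proper_list (C := T) (by simp [hT]) hEs (w := w)
    (by simp [w]) (fun x y => by simp only [w, hEs x y, eq_comm])
    (fun x y hxy => by simp only [w, if_neg hxy]; have := hE3 x y; omega)
    (Fintype.card V) Finset.univ Finset.card_univ hn (by
      -- The bound is $3n(n-1) - 6\binom{n-1}{2} = 6(n-1)$.
      obtain ⟨r, hr⟩ := Nat.exists_eq_add_of_le hn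
      rw [hsum] at htot
      rw [hr] at htot hTN ⊢
      have e1 : 2 + r - 1 = r + 1 := by omega
      rw [e1] at htot hTN ⊢
      have e2 := Nat.add_one_mul_choose_eq r 1
      simp only [Nat.choose_one_right] at e2
      nlinarith)
  refine G.hasProperHamiltonianPath_of_list (fun k : T => k.1) Subtype.val_injective
    (fun x y k hk => by simpa [E] using hk) p ?_ hp hnd (fun x => ?_)
  · rintro rfl
    have : (Finset.univ : Finset V).card = 0 := by rw [← hpS]; simp
    rw [Finset.card_univ] at this
    omega
  · rw [← List.mem_toFinset, hpS]
    exact Finset.mem_univ x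

/-- The complete multigraph on the nonzero vertices, with `0` isolated. -/
def completeWithIsolatedZero (m c : ℕ) : EdgeColouredMultigraph (Fin (m + 1)) c where
  edgeSet := (Sym2.map Fin.succ '' (⊤ : SimpleGraph (Fin m)).edgeSet) ×ˢ Set.univ
  loopless := by
    rintro ⟨e, k⟩ ⟨⟨e, he, rfl⟩, -⟩
    induction e using Sym2.ind
    simpa using he

theorem numEdges_completeWithIsolatedZero (m c : ℕ) :
    (completeWithIsolatedZero m c).numEdges = c * m.choose 2 := by
  rw [numEdges, completeWithIsolatedZero, Set.ncard_prod,
    Set.ncard_image_of_injective _ (Sym2.map.injective (Fin.succ_injective m)),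
    Set.ncard_eq_toFinset_card', ← SimpleGraph.edgeFinset,
    SimpleGraph.card_edgeFinset_top_eq_card_choose_two, Set.ncard_univ]
  simp [mul_comm]

theorem not_hasProperHamiltonianPath_completeWithIsolatedZero (m c : ℕ) (hm : 1 ≤ m) :
    ¬ (completeWithIsolatedZero m c).HasProperHamiltonianPath := by
  rintro ⟨l, P, hP, -⟩
  have hzero : ∀ e k, (e, k) ∈ (completeWithIsolatedZero m c).edgeSet → (0 : Fin (m + 1)) ∉ e := by
    rintro e k ⟨⟨e, -, rfl⟩, -⟩
    simp [Sym2.mem_map, Fin.succ_ne_zero]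
  have hcard := Fintype.card_le_of_surjective _ hP
  simp only [Fintype.card_fin] at hcard
  obtain ⟨i, hi⟩ := hP 0
  obtain rfl | ⟨j, rfl⟩ := i.eq_zero_or_eq_succ
  · refine hzero _ _ (P.edge_mem ⟨0, by omega⟩) ?_
    rw [Sym2.mem_iff, ← hi]
    exact Or.inl rfl
  · refine hzero _ _ (P.edge_mem j) ?_
    rw [Sym2.mem_iff, ← hi]
    exact Or.inr rfl

end EdgeColouredMultigraph

theorem theorem3 (c n : ℕ) (hc : 3 ≤ c) (hn : 2 ≤ n) :
    (∀ (V : Type*) [Fintype V] (G : EdgeColouredMultigraph V c),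
      Fintype.card V = n →
      c * (n - 1).choose 2 + 1 ≤ G.numEdges →
      G.HasProperHamiltonianPath) ∧
    (∃ G : EdgeColouredMultigraph (Fin n) c,
      G.numEdges = c * (n - 1).choose 2 ∧ ¬ G.HasProperHamiltonianPath) := by
  refine ⟨fun V _ G hV h => ?_, ?_⟩
  · subst hV
    exact G.hasProperHamiltonianPath_of_le hc hn h
  · obtain ⟨m, rfl⟩ := Nat.exists_eq_add_of_le' (by omega : 1 ≤ n)
    exact ⟨_, EdgeColouredMultigraph.numEdges_completeWithIsolatedZero m c,
      EdgeColouredMultigraph.not_hasProperHamiltonianPath_completeWithIsolatedZero m c (by omega)⟩
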